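/- Let $N\ge 1$ be an integer, let $U:(0,\infty)\to\mathbb{R}$ be smooth, and let $u(x)=U(|x|)$ be the corresponding radial function on $\mathbb{R}^N$ (smooth on $\mathbb{R}^N\setminus\{0\}$; derivatives of $u$ are the pointwise ones on $\mathbb{R}^N\setminus\{0\}$, and all integrals below are of non-negative functions and take values in $[0,\infty]$). Let $|\mathbb{S}^{N-1}|$ denote the surface measure of the unit sphere of $\mathbb{R}^N$. (i) Let $m\ge 1$ be an integer with $N\ge 2m-1$, and suppose that $$\lim_{r\to 0^+}\Big(\frac{U'(r)}{r}\Big)^{(2m-2)} r^{N/2}=0\quad\text{and}\quad \lim_{r\to\infty}\Big(\frac{U'(r)}{r}\Big)^{(2m-2)} r^{N/2}=0 .$$ Then $$\int_{\mathbb{R}^N}|\Delta^m u|^2\,dx\ \ge\ |\mathbb{S}^{N-1}|\int_0^\infty \big|U^{(2m)}(r)\big|^2 r^{N-1}\,dr .$$ (ii) Let $m\ge 0$ be an integer with $N\ge 2m$, and, if $m\ge 1$, suppose that $$\lim_{r\to 0^+}\Big(\frac{U'(r)}{r}\Big)^{(2m-1)} r^{N/2}=0\quad\text{and}\quad \lim_{r\to\infty}\Big(\frac{U'(r)}{r}\Big)^{(2m-1)}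 r^{N/2}=0 .$$ Then $$\int_{\mathbb{R}^N}|\nabla\Delta^m u|^2\,dx\ \ge\ |\mathbb{S}^{N-1}|\int_0^\infty \big|U^{(2m+1)}(r)\big|^2 r^{N-1}\,dr .$$ Here $f^{(k)}$ denotes the $k$-th derivative with respect to $r$. -/

import Mathlib

open Set Filter Topology MeasureTheory
open scoped ContDiff ENNReal

/-- The radial function `u(x) = U(|x|)` on `ℝ^N` with profile `U`. -/
noncomputable def radialFun (N : ℕ) (U : ℝ → ℝ) : EuclideanSpace ℝ (Fin N) → ℝ :=
  fun x => U ‖x‖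

/-- The iterated Laplacian `Δ^m u` of a function on `ℝ^N`. Its value at a point only depends on
`u` near that point. -/
noncomputable def iterLaplacian (N m : ℕ) (u : EuclideanSpace ℝ (Fin N) → ℝ) :
    EuclideanSpace ℝ (Fin N) → ℝ :=
  (fun w : EuclideanSpace ℝ (Fin N) → ℝ => Laplacian.laplacian w)^[m] u

/-- The surface measure `|𝕊^{N-1}|` of the unit sphere of `ℝ^N` (so `|𝕊^0| = 2`). -/
noncomputable def sphereArea (N : ℕ) : ℝ≥0∞ :=
  (volume : Measure (EuclideanSpace ℝ (Fin N))).toSphere Set.univ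

/-- The profile `(U'/r)^{(k)}(r) * r^{N/2}` that appears in the decay condition. -/
noncomputable def decayProfile (N k : ℕ) (U : ℝ → ℝ) : ℝ → ℝ :=
  fun r => iteratedDeriv k (fun s => deriv U s / s) r * r ^ ((N : ℝ) / 2)

/-! In the variable `r = exp t`, with `y t = exp (a * t) * U (exp t)`, all operators have constant
coefficients. For `K = 2m` or `2m + 1` and `a = N / 2 - K`, the weighted L² norm of `U^(K)` is the
norm of `∏_{j < K} (D - (a + j)) y`. The iterated Laplacian (or its gradient) gives the same
product, except that each odd factor `D + α_l`, `α_l = -(a + 2l + 1)`, becomes `D + β_l`, `β_l = N -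
2 - a - 2l`.

Since `|α_l| ≤ β_l`, and since `∫ (h' + βh)² - (h' + αh)²` equals `(β² - α²) ∫ h²` plus the boundary
term `(β - α) [h²]`, each exchange of a factor lowers the norm as soon as `h → 0` at `-∞`
(`sqNorm_D_add_le`, `sqNorm_diffOp_prod_le`).

That vanishing is the crux. Let `z` be `y` after the common factors. If the larger norm is finite,
`∏ (D + β_l) z` is in L², so `z` is a combination of the `exp (-β_l t)` up to a part vanishing at
`-∞` with its derivatives of order less than `m` (`exists_eq_sum_expFun_add`). The decay at `r → 0`
says that `∏_{l ≠ 0} (D + α_l) z → 0`. As `N ≥ 2m - 1`, this symbol is nonzero at every `-β_i`, so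
no exponential occurs (`vanishAtBot_of_tendsto`). -/

/-- The space of smooth real functions on the line. -/
def smoothFun : Submodule ℝ (ℝ → ℝ) where
  carrier := {f | ContDiff ℝ ∞ f}
  add_mem' hf hg := by
    rw [mem_ofPred_eq] at *
    exact hf.add hg
  zero_mem' := by
    rw [mem_ofPred_eq]
    exact contDiff_const
  smul_mem' c _ hf := by
    rw [mem_ofPred_eq] at *
    exact contDiff_const.smul hf

/-! ### Constant-coefficient operators on smooth functions. -/

namespace smoothFun

lemma mem_iff {f : ℝ → ℝ} : f ∈ smoothFun ↔ ContDiff ℝ ∞ f := by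
  rw [← SetLike.mem_coe]
  exact mem_ofPred_eq ▸ Iff.rfl

lemma contDiff (f : smoothFun) : ContDiff ℝ ∞ f.1 := mem_iff.1 f.2

lemma differentiable (f : smoothFun) : Differentiable ℝ f.1 := (contDiff f).differentiable (by simp)

/-- Differentiation as an endomorphism of the space of smooth functions. -/
noncomputable def D : Module.End ℝ smoothFun where
  toFun f := ⟨deriv f.1, mem_iff.2 (contDiff_infty_iff_deriv.1 (contDiff f)).2⟩
  map_add' f g := by
    ext t
    exact deriv_add (differentiable f t) (differentiable g t)
  map_smul' c f := by
    ext t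
    exact deriv_const_smul c (differentiable f t)

lemma hasDerivAt (f : smoothFun) (t : ℝ) : HasDerivAt f.1 ((D f).1 t) t :=
  (differentiable f t).hasDerivAt

lemma continuous (f : smoothFun) : Continuous f.1 := (contDiff f).continuous

/-- The constant coefficient differential operator `p(d/dt)`. -/
noncomputable def diffOp (p : Polynomial ℝ) : Module.End ℝ smoothFun := Polynomial.aeval D p

lemma diffOp_mul (p q : Polynomial ℝ) (f : smoothFun) :
    diffOp (p * q) f = diffOp p (diffOp q f) := by
  simp [diffOp]

lemma diffOp_X_add_C (c : ℝ) (f : smoothFun) :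
    diffOp (Polynomial.X + Polynomial.C c) f = D f + c • f := by
  simp [diffOp, Algebra.algebraMap_eq_smul_one]

/-- The exponential `t ↦ exp (c * t)`. -/
noncomputable def expFun (c : ℝ) : smoothFun :=
  ⟨fun t => Real.exp (c * t), mem_iff.2 (contDiff_const.mul contDiff_id).exp⟩

lemma D_expFun (c : ℝ) : D (expFun c) = c • expFun c := by
  ext t
  have : HasDerivAt (fun t => Real.exp (c * t)) (Real.exp (c * t) * (c * 1)) t :=
    ((hasDerivAt_id t).const_mul c).exp
  refine this.deriv.trans ?_
  change _ = c * Real.exp (c * t)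
  ring

lemma diffOp_expFun (p : Polynomial ℝ) (c : ℝ) :
    diffOp p (expFun c) = p.eval c • expFun c := by
  refine Module.End.aeval_apply_of_hasEigenvector (f := D) ⟨?_, fun h => ?_⟩
  · rw [Module.End.mem_eigenspace_iff, D_expFun]
  · exact (Real.exp_pos (c * 0)).ne' (congrFun (congrArg Subtype.val h) 0)

/-! ### Solutions of linear equations near `-∞`. -/

/-- The derivatives of order less than `n` vanish at `-∞`. -/
def VanishAtBot (n : ℕ) (f : smoothFun) : Prop :=
  ∀ j < n, Tendsto ((D ^ j) f).1 atBot (𝓝 0)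

lemma VanishAtBot.tendsto_diffOp {n : ℕ} {f : smoothFun} (hf : VanishAtBot n f) {p : Polynomial ℝ}
    (hp : p.natDegree < n) : Tendsto (diffOp p f).1 atBot (𝓝 0) := by
  have h : (diffOp p f).1 = fun t =>
      ∑ j ∈ Finset.range (p.natDegree + 1), p.coeff j * ((D ^ j) f).1 t := by
    ext t
    simp [diffOp, Polynomial.aeval_eq_sum_range, LinearMap.sum_apply]
  rw [h]
  have : (0 : ℝ) = ∑ j ∈ Finset.range (p.natDegree + 1), p.coeff j * 0 := by simp
  rw [this]
  refine tendsto_finsetSum _ fun j hj => (hf j ?_).const_mul _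
  have := Finset.mem_range.1 hj
  omega

/-- A function which near `-∞` is, for every `δ`, bounded by `δ` plus a function of integral at
most `δ`. -/
def SmallAtBot (g : ℝ → ℝ) : Prop :=
  ∀ δ > 0, ∃ T : ℝ, ∃ ψ : ℝ → ℝ, (∀ t, 0 ≤ ψ t) ∧ IntegrableOn ψ (Iic T) ∧
    ∫ t in Iic T, ψ t ≤ δ ∧ ∀ t ≤ T, |g t| ≤ δ + ψ t

lemma smallAtBot_of_tendsto {g : ℝ → ℝ} (hg : Tendsto g atBot (𝓝 0)) : SmallAtBot g := by
  intro δ hδ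
  obtain ⟨T, hT⟩ := eventually_atBot.1 ((Metric.tendsto_nhds.1 hg) δ hδ)
  refine ⟨T, 0, fun _ => le_rfl, integrableOn_zero, by simpa using hδ.le, fun t ht => ?_⟩
  simpa using (hT t ht).le

lemma tendsto_setIntegral_Iic_atBot {f : ℝ → ℝ} (hf : Integrable f) :
    Tendsto (fun t => ∫ s in Iic t, f s) atBot (𝓝 0) := by
  have h := intervalIntegral_tendsto_integral_Iic (μ := volume) (f := f) 0 hf.integrableOn tendsto_id
  have h2 : (fun t => ∫ s in Iic t, f s) =
      fun t => (∫ s in Iic 0, f s) - ∫ s in t..0, f s := by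
    ext t
    rw [← intervalIntegral.integral_Iic_sub_Iic hf.integrableOn hf.integrableOn]
    ring
  rw [h2]
  simpa using h.const_sub (∫ s in Iic 0, f s)

/-- By Young's inequality `|g| ≤ δ + g² / δ`; the second term has small integral far to the left. -/
lemma smallAtBot_of_integrable_sq {g : ℝ → ℝ} (hg : Integrable fun t => g t ^ 2) :
    SmallAtBot g := by
  intro δ hδ
  obtain ⟨T, hT⟩ := eventually_atBot.1
    ((Metric.tendsto_nhds.1 (tendsto_setIntegral_Iic_atBot hg)) (δ ^ 2) (by positivity))
  refine ⟨T, fun t => g t ^ 2 / δ, fun t => by positivity, (hg.div_const δ).integrableOn, ?_,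
    fun t _ => ?_⟩
  · have h := hT T le_rfl
    rw [Real.dist_eq, sub_zero] at h
    rw [integral_div, div_le_iff₀ hδ]
    nlinarith [le_abs_self (∫ t in Iic T, g t ^ 2)]
  · have : |g t| * δ ≤ δ * δ + g t ^ 2 := by
      nlinarith [sq_nonneg (|g t| - δ), sq_abs (g t), abs_nonneg (g t)]
    have h2 : |g t| ≤ (δ * δ + g t ^ 2) / δ := (le_div_iff₀ hδ).2 this
    refine h2.trans_eq ?_
    field_simp

/-- On `(-∞, t]` the weight `exp (β s)` has integral `exp (β t) / β` and supremum `exp (β t)`. The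
first controls the constant part of the majorant of `g`, the second its integrable part. -/
lemma SmallAtBot.weighted {g : ℝ → ℝ} (hg : SmallAtBot g) (hc : Continuous g) {β : ℝ}
    (hβ : 0 < β) :
    (∀ t, IntegrableOn (fun s => Real.exp (β * s) * g s) (Iic t)) ∧
      Tendsto (fun t => Real.exp (-β * t) * ∫ s in Iic t, Real.exp (β * s) * g s) atBot (𝓝 0) := by
  have hcont : Continuous fun s => Real.exp (β * s) * g s := by fun_prop
  have key : ∀ δ > 0, ∃ T : ℝ, ∀ t ≤ T, IntegrableOn (fun s => Real.exp (β * s) * g s) (Iic t) ∧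
      |∫ s in Iic t, Real.exp (β * s) * g s| ≤ Real.exp (β * t) * (δ / β + δ) := by
    intro δ hδ
    obtain ⟨T, ψ, hψ0, hψi, hψδ, hgψ⟩ := hg δ hδ
    refine ⟨T, fun t ht => ?_⟩
    have hψt : IntegrableOn ψ (Iic t) := hψi.mono_set (Iic_subset_Iic.2 ht)
    have hexp := integrableOn_exp_mul_Iic hβ t
    have hmaj : IntegrableOn (fun s => δ * Real.exp (β * s) + Real.exp (β * t) * ψ s) (Iic t) :=
      (hexp.const_mul δ).add (hψt.const_mul _)
    have hle : ∀ s ∈ Iic t, ‖Real.exp (β * s) * g s‖ ≤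
        δ * Real.exp (β * s) + Real.exp (β * t) * ψ s := by
      intro s hs
      have hs' : s ≤ t := hs
      have h1 : Real.exp (β * s) ≤ Real.exp (β * t) :=
        Real.exp_le_exp.2 (mul_le_mul_of_nonneg_left hs' hβ.le)
      rw [norm_mul, Real.norm_eq_abs, Real.norm_eq_abs, abs_of_pos (Real.exp_pos _)]
      have h2 := mul_le_mul_of_nonneg_left (hgψ s (hs'.trans ht)) (Real.exp_pos (β * s)).le
      have h3 := mul_le_mul_of_nonneg_right h1 (hψ0 s)
      linarith
    refine ⟨Integrable.mono' hmaj hcont.aestronglyMeasurable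
      ((ae_restrict_iff' measurableSet_Iic).2 (Eventually.of_forall hle)), ?_⟩
    have h1 := norm_integral_le_of_norm_le hmaj
      ((ae_restrict_iff' measurableSet_Iic).2 (Eventually.of_forall hle))
    rw [integral_add (hexp.const_mul δ) (hψt.const_mul _), integral_const_mul, integral_const_mul,
      integral_exp_mul_Iic hβ] at h1
    have h2 : ∫ s in Iic t, ψ s ≤ δ :=
      (setIntegral_mono_set hψi (Eventually.of_forall hψ0)
        (Iic_subset_Iic.2 ht).eventuallyLE).trans hψδ
    have h3 := mul_le_mul_of_nonneg_left h2 (Real.exp_pos (β * t)).le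
    rw [Real.norm_eq_abs] at h1
    calc _ ≤ _ := h1
      _ ≤ δ * (Real.exp (β * t) / β) + Real.exp (β * t) * δ := by gcongr
      _ = _ := by ring
  constructor
  · intro t
    obtain ⟨T, hT⟩ := key 1 one_pos
    have h1 := (hT (min T t) (min_le_left _ _)).1
    have h2 : IntegrableOn (fun s => Real.exp (β * s) * g s) (Icc (min T t) t) :=
      hcont.continuousOn.integrableOn_compact isCompact_Icc
    have h3 := h1.union h2
    rwa [Iic_union_Icc_eq_Iic (min_le_right _ _)] at h3
  · rw [Metric.tendsto_nhds]
    intro ε hε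
    set δ := ε / (2 * (1 / β + 1)) with hδ
    have hδ0 : 0 < δ := by positivity
    obtain ⟨T, hT⟩ := key δ hδ0
    filter_upwards [eventually_le_atBot T] with t ht
    rw [Real.dist_eq, sub_zero, abs_mul, abs_of_pos (Real.exp_pos _)]
    have h1 := mul_le_mul_of_nonneg_left (hT t ht).2 (Real.exp_pos (-β * t)).le
    have h2 : Real.exp (-β * t) * (Real.exp (β * t) * (δ / β + δ)) = δ / β + δ := by
      rw [← mul_assoc, ← Real.exp_add]
      simp
    have h3 : δ / β + δ = ε / 2 := by
      rw [hδ]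
      field_simp
    linarith

/-- Variation of constants: `(exp (β t) f)' = exp (β t) g`, so `exp (β t) f` has a limit at `-∞`,
and this limit is `c`. -/
lemma exists_sub_expFun_tendsto_zero {f g : smoothFun} {β : ℝ} (hβ : 0 < β)
    (hfg : D f + β • f = g) (hg : SmallAtBot g.1) :
    ∃ c : ℝ, Tendsto (f - c • expFun (-β)).1 atBot (𝓝 0) := by
  obtain ⟨hint, hlim⟩ := hg.weighted (continuous g) hβ
  have hder : ∀ t, HasDerivAt (fun t => Real.exp (β * t) * f.1 t) (Real.exp (β * t) * g.1 t) t := by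
    intro t
    have h1 : HasDerivAt (fun t => Real.exp (β * t)) (Real.exp (β * t) * (β * 1)) t :=
      ((hasDerivAt_id t).const_mul β).exp
    refine (h1.mul (hasDerivAt f t)).congr_deriv ?_
    rw [← hfg]
    change _ = Real.exp (β * t) * ((D f).1 t + β * f.1 t)
    ring
  have hgc := (continuous g)
  refine ⟨f.1 0 - ∫ s in Iic 0, Real.exp (β * s) * g.1 s, hlim.congr fun t => ?_⟩
  have h1 : ∫ s in t..0, Real.exp (β * s) * g.1 s =
      Real.exp (β * 0) * f.1 0 - Real.exp (β * t) * f.1 t :=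
    intervalIntegral.integral_eq_sub_of_hasDerivAt (fun s _ => hder s)
      (Continuous.intervalIntegrable (by fun_prop) _ _)
  rw [← intervalIntegral.integral_Iic_sub_Iic (hint t) (hint 0), mul_zero, Real.exp_zero] at h1
  have h2 : Real.exp (-β * t) * Real.exp (β * t) = 1 := by
    rw [← Real.exp_add]; simp
  change _ = f.1 t - _ * Real.exp (-β * t)
  have h3 : ∫ s in Iic t, Real.exp (β * s) * g.1 s = Real.exp (β * t) * f.1 t -
      (f.1 0 - ∫ s in Iic 0, Real.exp (β * s) * g.1 s) := by linarith
  rw [h3, mul_sub, ← mul_assoc, h2]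
  ring

/-- The equation expresses `D^(j+1) h` as `D^j g - β D^j h`, so one more derivative is controlled
than for `g`. -/
lemma VanishAtBot.of_D_add {n : ℕ} {g h : smoothFun} {β : ℝ} (hg : VanishAtBot n g)
    (hgh : D h + β • h = g) (hh : Tendsto h.1 atBot (𝓝 0)) : VanishAtBot (n + 1) h := by
  intro j
  induction j with
  | zero => intro _; simpa using hh
  | succ j ih =>
    intro hj
    have h1 : (D ^ (j + 1)) h = (D ^ j) g - β • (D ^ j) h := by
      rw [← hgh, pow_succ, Module.End.mul_apply, map_add, map_smul]
      abel
    rw [h1]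
    have := (hg j (by omega)).sub ((ih (by omega)).const_mul β)
    rw [mul_zero, sub_zero] at this
    exact this

open Polynomial in
/-- Solutions of `∏ (d/dt + β i) z = F` with `F` small at `-∞` are exponentials up to a part which
vanishes at `-∞`. -/
lemma exists_eq_sum_expFun_add {ι : Type*} [DecidableEq ι] (β : ι → ℝ) (s : Finset ι)
    (hpos : ∀ i ∈ s, 0 < β i) (hinj : Set.InjOn β s) (z : smoothFun)
    (hz : SmallAtBot (diffOp (∏ i ∈ s, (X + C (β i))) z).1) :
    ∃ (c : ι → ℝ) (g : smoothFun), z = ∑ i ∈ s, c i • expFun (-β i) + g ∧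
      VanishAtBot s.card g ∧ SmallAtBot g.1 := by
  induction s using Finset.induction_on generalizing z with
  | empty => exact ⟨0, z, by simp, fun j hj => by simp at hj, by simpa [diffOp] using hz⟩
  | insert a s ha ih =>
    rw [Finset.prod_insert ha, mul_comm, diffOp_mul] at hz
    obtain ⟨c, g, hzg, hg, hgs⟩ := ih (fun i hi => hpos i (Finset.mem_insert_of_mem hi))
      (hinj.mono (by simp)) _ hz
    rw [diffOp_X_add_C] at hzg
    -- As `(D + β a) exp (-β i t) = (β a - β i) exp (-β i t)`, the subtracted sum is a particular
    -- solution for the exponential part of the right-hand side.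
    set f : smoothFun := z - ∑ i ∈ s, (c i / (β a - β i)) • expFun (-β i) with hf
    have hne : ∀ i ∈ s, β a - β i ≠ 0 := fun i hi h =>
      ha (hinj (by simp) (by simp [hi]) (sub_eq_zero.1 h) ▸ hi)
    have hfg : D f + β a • f = g := by
      have h1 : D (∑ i ∈ s, (c i / (β a - β i)) • expFun (-β i)) +
          β a • (∑ i ∈ s, (c i / (β a - β i)) • expFun (-β i)) =
          ∑ i ∈ s, c i • expFun (-β i) := by
        rw [map_sum, Finset.smul_sum, ← Finset.sum_add_distrib]
        refine Finset.sum_congr rfl fun i hi => ?_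
        rw [map_smul, D_expFun, smul_smul, smul_smul, ← add_smul]
        congr 1
        field_simp [hne i hi]
        ring
      rw [hf, map_sub, smul_sub]
      rw [← eq_sub_iff_add_eq'] at hzg
      rw [hzg, ← h1]
      abel
    have hβa : 0 < β a := hpos a (by simp)
    obtain ⟨d, hd⟩ := exists_sub_expFun_tendsto_zero hβa hfg hgs
    refine ⟨fun i => if i = a then d else c i / (β a - β i), f - d • expFun (-β a), ?_, ?_,
      smallAtBot_of_tendsto hd⟩
    · simp only [Finset.sum_insert ha, if_true]
      rw [Finset.sum_congr rfl (g := fun i =>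
        (c i / (β a - β i)) • expFun (-β i)) fun i hi => by
          rw [if_neg (fun h : i = a => ha (h ▸ hi))]]
      rw [hf]
      abel
    · rw [Finset.card_insert_of_notMem ha]
      refine hg.of_D_add (β := β a) ?_ hd
      rw [← hfg, map_sub, map_smul, D_expFun, smul_sub, smul_smul, smul_smul, neg_eq_neg_one_mul,
        ← mul_assoc]
      module

/-- Multiplying by `exp (β a t)`, where `β a` is the largest exponent with nonzero coefficient,
leaves `d a` in the limit at `-∞`, while the product tends to `0`. -/
lemma coeff_eq_zero_of_sum_exp_tendsto_zero {ι : Type*} (β d : ι → ℝ) (s : Finset ι)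
    (hpos : ∀ i ∈ s, 0 < β i) (hinj : Set.InjOn β s)
    (h : Tendsto (fun t => ∑ i ∈ s, d i * Real.exp (-β i * t)) atBot (𝓝 0)) :
    ∀ i ∈ s, d i = 0 := by
  classical
  by_contra! hcon
  obtain ⟨i₁, hi₁, hdi₁⟩ := hcon
  obtain ⟨a, ha, hmax⟩ := (s.filter fun i => d i ≠ 0).exists_max_image β
    ⟨i₁, Finset.mem_filter.2 ⟨hi₁, hdi₁⟩⟩
  obtain ⟨has, hda⟩ := Finset.mem_filter.1 ha
  have hexp : ∀ c : ℝ, 0 < c → Tendsto (fun t => Real.exp (c * t)) atBot (𝓝 0) := fun c hc =>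
    Real.tendsto_exp_atBot.comp (tendsto_id.const_mul_atBot hc)
  have h1 := (hexp _ (hpos a has)).mul h
  rw [mul_zero] at h1
  have h2 : Tendsto (fun t => ∑ i ∈ s, d i * Real.exp ((β a - β i) * t)) atBot
      (𝓝 (∑ i ∈ s, if i = a then d a else 0)) := by
    refine tendsto_finsetSum _ fun i hi => ?_
    split_ifs with hia
    · subst hia; simp
    · by_cases hdi : d i = 0
      · simp [hdi]
      · have h3 : β i < β a := lt_of_le_of_ne (hmax i (Finset.mem_filter.2 ⟨hi, hdi⟩))
          fun h => hia (hinj hi has h)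
        simpa using (hexp _ (sub_pos.2 h3)).const_mul (d i)
  rw [Finset.sum_ite_eq' s a, if_pos has] at h2
  refine hda (tendsto_nhds_unique h2 (h1.congr fun t => ?_))
  rw [Finset.mul_sum]
  refine Finset.sum_congr rfl fun i _ => ?_
  rw [mul_left_comm, ← Real.exp_add]
  ring_nf

end smoothFun

/-! ### Comparison of L² norms, one factor at a time. -/

namespace smoothFun

/-- The square of the `L²` norm on the line. -/
noncomputable def sqNorm (f : smoothFun) : ℝ≥0∞ := ∫⁻ t, ENNReal.ofReal (f.1 t ^ 2)

lemma sqNorm_D_add_le {h : smoothFun} (hh : Tendsto h.1 atBot (𝓝 0)) {α β : ℝ} (hαβ : |α| ≤ β) :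
    sqNorm (D h + α • h) ≤ sqNorm (D h + β • h) := by
  have hc := continuous h
  have hc' := continuous (D h)
  obtain ⟨h1, h2⟩ := abs_le.1 hαβ
  have hcov : AECover volume atTop fun n : ℝ => Ioc (-n) n :=
    aecover_Ioc tendsto_neg_atTop_atBot tendsto_id
  have hlim : ∀ c : ℝ, Tendsto (fun n : ℝ => ∫⁻ t in Ioc (-n) n,
      ENNReal.ofReal ((D h + c • h).1 t ^ 2)) atTop (𝓝 (sqNorm (D h + c • h))) := fun c =>
    hcov.lintegral_tendsto_of_countably_generated
      (by have := continuous (D h + c • h); fun_prop)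
  have hbd : Tendsto (fun n : ℝ => ENNReal.ofReal ((β - α) * h.1 (-n) ^ 2)) atTop (𝓝 0) := by
    have := ENNReal.tendsto_ofReal
      (((hh.comp tendsto_neg_atTop_atBot).pow 2).const_mul (β - α))
    simpa using this
  have hsum := (hlim β).add hbd
  rw [add_zero] at hsum
  refine le_of_tendsto_of_tendsto (hlim α) hsum ?_
  filter_upwards [eventually_ge_atTop 0] with n hn
  have hle : -n ≤ n := by linarith
  have hconv : ∀ c : ℝ, ∫⁻ t in Ioc (-n) n, ENNReal.ofReal ((D h + c • h).1 t ^ 2) =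
      ENNReal.ofReal (∫ t in (-n)..n, (D h + c • h).1 t ^ 2) := by
    intro c
    have := continuous (D h + c • h)
    rw [intervalIntegral.integral_of_le hle, ofReal_integral_eq_lintegral_ofReal]
    · exact (Continuous.intervalIntegrable (by fun_prop) _ _).1
    · exact Eventually.of_forall fun t => sq_nonneg _
  rw [hconv, hconv, ← ENNReal.ofReal_add
    (intervalIntegral.integral_nonneg hle fun t _ => sq_nonneg _)
    (mul_nonneg (by linarith) (sq_nonneg _))]
  refine ENNReal.ofReal_le_ofReal ?_
  have hder : ∀ t, HasDerivAt (fun t => (β - α) * h.1 t ^ 2) ((β - α) * (2 * h.1 t * (D h).1 t)) t := by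
    intro t
    simpa using ((hasDerivAt h t).pow 2).const_mul (β - α)
  have hftc : ∫ t in (-n)..n, (β - α) * (2 * h.1 t * (D h).1 t) =
      (β - α) * h.1 n ^ 2 - (β - α) * h.1 (-n) ^ 2 :=
    intervalIntegral.integral_eq_sub_of_hasDerivAt (fun s _ => hder s)
      (Continuous.intervalIntegrable (by fun_prop) _ _)
  have hcα := continuous (D h + α • h)
  have hcβ := continuous (D h + β • h)
  have hmono : ∫ t in (-n)..n, ((D h + α • h).1 t ^ 2 + (β - α) * (2 * h.1 t * (D h).1 t)) ≤
      ∫ t in (-n)..n, (D h + β • h).1 t ^ 2 := by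
    refine intervalIntegral.integral_mono_on hle
      (Continuous.intervalIntegrable (by fun_prop) _ _)
      (Continuous.intervalIntegrable (by fun_prop) _ _) fun t _ => ?_
    change ((D h).1 t + α * h.1 t) ^ 2 + _ ≤ ((D h).1 t + β * h.1 t) ^ 2
    -- The two sides differ by `(β² - α²) h² = (β - α) (β + α) h²`.
    nlinarith [mul_nonneg (mul_nonneg (sub_nonneg.2 h2) (neg_le_iff_add_nonneg.1 h1))
      (sq_nonneg (h.1 t))]
  rw [intervalIntegral.integral_add (Continuous.intervalIntegrable (by fun_prop) _ _)
    (Continuous.intervalIntegrable (by fun_prop) _ _), hftc] at hmono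
  -- The boundary term at the right end has the favourable sign, so only the one at `-n` must tend
  -- to zero.
  have : 0 ≤ (β - α) * h.1 n ^ 2 := mul_nonneg (sub_nonneg.2 h2) (sq_nonneg _)
  linarith

lemma integrable_sq_of_sqNorm_ne_top {f : smoothFun} (hf : sqNorm f ≠ ⊤) :
    Integrable fun t => f.1 t ^ 2 := by
  have hc := continuous f
  refine ⟨by fun_prop, ?_⟩
  rw [hasFiniteIntegral_iff_ofReal (Eventually.of_forall fun t => sq_nonneg _)]
  exact hf.lt_top

open Polynomial

lemma natDegree_prod_X_add_C {ι : Type*} (s : Finset ι) (a : ι → ℝ) :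
    (∏ i ∈ s, (X + C (a i))).natDegree = s.card := by
  rw [natDegree_prod_of_monic _ _ fun i _ => monic_X_add_C (a i)]
  simp

/-- If `z` solves `∏ (d/dt + β i) z = F` with `F` small at `-∞`, and `∏ (d/dt + α i) z`, taken over
one index less, vanishes at `-∞`, then `z` vanishes there. -/
lemma vanishAtBot_of_tendsto {ι : Type*} [DecidableEq ι] {α β : ι → ℝ} {s : Finset ι}
    (hpos : ∀ i ∈ s, 0 < β i) (hinj : Set.InjOn β s) {a : ι} (ha : a ∈ s)
    (hne : ∀ l ∈ s.erase a, ∀ i ∈ s, α l ≠ β i) {z : smoothFun}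
    (hz : SmallAtBot (diffOp (∏ i ∈ s, (X + C (β i))) z).1)
    (hw : Tendsto (diffOp (∏ i ∈ s.erase a, (X + C (α i))) z).1 atBot (𝓝 0)) :
    VanishAtBot s.card z := by
  obtain ⟨c, g, hzg, hg, -⟩ := exists_eq_sum_expFun_add β s hpos hinj z hz
  set P := ∏ i ∈ s.erase a, (X + C (α i)) with hP
  have hPg : Tendsto (diffOp P g).1 atBot (𝓝 0) := hg.tendsto_diffOp (by
    rw [hP, natDegree_prod_X_add_C]
    exact Finset.card_erase_lt_of_mem ha)
  have hsub := hw.sub hPg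
  rw [sub_zero] at hsub
  have hsum : Tendsto (fun t => ∑ i ∈ s, (c i * P.eval (-β i)) * Real.exp (-β i * t)) atBot
      (𝓝 0) := by
    refine hsub.congr fun t => ?_
    have h1 : diffOp P z - diffOp P g = ∑ i ∈ s, (c i * P.eval (-β i)) • expFun (-β i) := by
      rw [hzg, map_add, add_sub_cancel_right, map_sum]
      refine Finset.sum_congr rfl fun i _ => ?_
      rw [map_smul, diffOp_expFun, smul_smul]
    change (diffOp P z - diffOp P g).1 t = _
    rw [h1]
    simp [expFun]
  have hc := coeff_eq_zero_of_sum_exp_tendsto_zero β _ s hpos hinj hsum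
  have hzero : ∀ i ∈ s, c i = 0 := by
    intro i hi
    refine (mul_eq_zero.1 (hc i hi)).resolve_right ?_
    rw [hP, eval_prod]
    -- `P.eval (-β i)` is the product of the `α l - β i`, which `hne` keeps away from zero.
    refine Finset.prod_ne_zero_iff.2 fun l hl => ?_
    have := hne l hl i hi
    rw [eval_add, eval_X, eval_C]
    intro h
    exact this (by linarith)
  rw [hzg, Finset.sum_eq_zero fun i hi => by rw [hzero i hi, zero_smul], zero_add]
  exact hg

/-- Replace `β` by `α` index by index. At each stage the other factors form `q` of degree below
`s.card`, so `diffOp q z` vanishes at `-∞` and the one-factor inequality applies to it. -/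
lemma sqNorm_diffOp_prod_le {ι : Type*} [DecidableEq ι] {α β : ι → ℝ} {s : Finset ι}
    (hle : ∀ i ∈ s, |α i| ≤ β i) {z : smoothFun} (hz : VanishAtBot s.card z) :
    sqNorm (diffOp (∏ i ∈ s, (X + C (α i))) z) ≤ sqNorm (diffOp (∏ i ∈ s, (X + C (β i))) z) := by
  have key : ∀ u ⊆ s, sqNorm (diffOp ((∏ i ∈ u, (X + C (α i))) * ∏ i ∈ s \ u, (X + C (β i))) z) ≤
      sqNorm (diffOp (∏ i ∈ s, (X + C (β i))) z) := by
    intro u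
    induction u using Finset.induction_on with
    | empty => intro _; simp
    | insert a u ha ih =>
      intro hu
      have has : a ∈ s := hu (Finset.mem_insert_self a u)
      refine le_trans ?_ (ih ((Finset.subset_insert a u).trans hu))
      have hmem : a ∈ s \ u := Finset.mem_sdiff.2 ⟨has, ha⟩
      set q := (∏ i ∈ u, (X + C (α i))) * ∏ i ∈ s \ insert a u, (X + C (β i)) with hq
      have h1 : (∏ i ∈ insert a u, (X + C (α i))) * ∏ i ∈ s \ insert a u, (X + C (β i)) =
          (X + C (α a)) * q := by
        rw [Finset.prod_insert ha, hq, mul_assoc]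
      have h2 : (∏ i ∈ u, (X + C (α i))) * ∏ i ∈ s \ u, (X + C (β i)) = (X + C (β a)) * q := by
        rw [← Finset.mul_prod_erase _ _ hmem, hq, Finset.sdiff_insert]
        ring
      have hdeg : q.natDegree < s.card := by
        have h3 := Finset.card_sdiff_add_card_eq_card hu
        rw [Finset.card_insert_of_notMem ha] at h3
        refine natDegree_mul_le.trans_lt ?_
        rw [natDegree_prod_X_add_C, natDegree_prod_X_add_C]
        omega
      rw [h1, h2, diffOp_mul _ q, diffOp_mul _ q, diffOp_X_add_C, diffOp_X_add_C]
      exact sqNorm_D_add_le (hz.tendsto_diffOp hdeg) (hle a has)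
  simpa using key s subset_rfl

/-- Only a finite right-hand side needs proof, and finiteness is what makes the right-hand function
small at `-∞`. -/
theorem sqNorm_diffOp_prod_le_of_tendsto {ι : Type*} [DecidableEq ι] {α β : ι → ℝ} {s : Finset ι}
    (hle : ∀ i ∈ s, |α i| ≤ β i) (hpos : ∀ i ∈ s, 0 < β i) (hinj : Set.InjOn β s) {a : ι}
    (ha : a ∈ s) (hne : ∀ l ∈ s.erase a, ∀ i ∈ s, α l ≠ β i) {z : smoothFun}
    (hw : Tendsto (diffOp (∏ i ∈ s.erase a, (X + C (α i))) z).1 atBot (𝓝 0)) :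
    sqNorm (diffOp (∏ i ∈ s, (X + C (α i))) z) ≤ sqNorm (diffOp (∏ i ∈ s, (X + C (β i))) z) := by
  by_cases htop : sqNorm (diffOp (∏ i ∈ s, (X + C (β i))) z) = ⊤
  · rw [htop]
    exact le_top
  · exact sqNorm_diffOp_prod_le hle (vanishAtBot_of_tendsto hpos hinj ha hne
      (smallAtBot_of_integrable_sq (integrable_sq_of_sqNorm_ne_top htop)) hw)

end smoothFun

/-! ### The logarithmic variable. -/

/-- `g` is the function `t ↦ exp (a * t) * f (exp t)`, which expresses `f` on `(0, ∞)` in the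
logarithmic variable. -/
def IsLogLift (a : ℝ) (f : ℝ → ℝ) (g : smoothFun) : Prop :=
  ∀ t, g.1 t = Real.exp (a * t) * f (Real.exp t)

namespace IsLogLift

open smoothFun Polynomial

lemma exists_of_contDiffOn {f : ℝ → ℝ} (hf : ContDiffOn ℝ ∞ f (Ioi 0)) (a : ℝ) :
    ∃ g, IsLogLift a f g := by
  have h : ContDiff ℝ ∞ fun t => Real.exp (a * t) * f (Real.exp t) :=
    (contDiff_const.mul contDiff_id).exp.mul
      (hf.comp_contDiff Real.contDiff_exp fun t => Real.exp_pos t)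
  exact ⟨⟨_, mem_iff.2 h⟩, fun t => rfl⟩

variable {a : ℝ} {f : ℝ → ℝ} {g : smoothFun}

lemma apply_exp (h : IsLogLift a f g) (t : ℝ) : f (Real.exp t) = Real.exp (-a * t) * g.1 t := by
  rw [h t, ← mul_assoc, ← Real.exp_add]
  simp

lemma hasDerivAt (h : IsLogLift a f g) (t : ℝ) :
    HasDerivAt f (Real.exp (-(a + 1) * t) * ((D g).1 t - a * g.1 t)) (Real.exp t) := by
  have h1 : HasDerivAt (fun t => Real.exp (-a * t)) (Real.exp (-a * t) * (-a * 1)) t :=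
    ((hasDerivAt_id t).const_mul (-a)).exp
  have h2 := h1.mul (smoothFun.hasDerivAt g t)
  rw [← Real.log_exp t] at h2
  have h3 := h2.comp (Real.exp t) (Real.hasDerivAt_log (Real.exp_pos t).ne')
  rw [Real.log_exp] at h3
  refine (h3.congr_of_eventuallyEq ?_).congr_deriv ?_
  · filter_upwards [eventually_gt_nhds (Real.exp_pos t)] with r hr
    have := h.apply_exp (Real.log r)
    rwa [Real.exp_log hr] at this
  · rw [← Real.exp_neg, show -(a + 1) * t = -a * t + -t by ring, Real.exp_add]
    ring

lemma differentiableAt (h : IsLogLift a f g) {r : ℝ} (hr : 0 < r) : DifferentiableAt ℝ f r := by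
  have := (h.hasDerivAt (Real.log r)).differentiableAt
  rwa [Real.exp_log hr] at this

lemma continuousOn (h : IsLogLift a f g) : ContinuousOn f (Ioi 0) := fun _ hr =>
  (h.differentiableAt hr).continuousAt.continuousWithinAt

/-- Since `d/dr = exp (-t) d/dt`, raising the weight by one absorbs the factor `exp (-t)`, and
differentiating the old weight produces the shift `-a`. -/
lemma lift_deriv (h : IsLogLift a f g) : IsLogLift (a + 1) (deriv f) (diffOp (X + C (-a)) g) := by
  intro t
  rw [(h.hasDerivAt t).deriv, ← mul_assoc, ← Real.exp_add, diffOp_X_add_C]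
  change (D g).1 t + -a * g.1 t = _
  rw [← add_mul, add_neg_cancel, zero_mul, Real.exp_zero]
  ring

lemma lift_iteratedDeriv (h : IsLogLift a f g) (n : ℕ) :
    IsLogLift (a + n) (iteratedDeriv n f)
      (diffOp (∏ j ∈ Finset.range n, (X + C (-(a + j)))) g) := by
  induction n with
  | zero => simpa [diffOp] using h
  | succ n ih =>
    rw [iteratedDeriv_succ, Finset.prod_range_succ, mul_comm, diffOp_mul, Nat.cast_succ, ← add_assoc]
    exact ih.lift_deriv

lemma lift_div_id (h : IsLogLift a f g) : IsLogLift (a + 1) (fun r => f r / r) g := by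
  intro t
  rw [h t, add_mul, Real.exp_add, one_mul]
  field_simp

end IsLogLift

/-! ### Radial functions and polar coordinates. -/

/-- The Laplacian on radial functions of `ℝ^N`, acting on profiles. -/
noncomputable def radialLaplacian (N : ℕ) (f : ℝ → ℝ) : ℝ → ℝ :=
  fun r => r * deriv (fun s => deriv f s / s) r + N * (deriv f r / r)

section radial

variable {E : Type*} [NormedAddCommGroup E] [InnerProductSpace ℝ E]

lemma hasFDerivAt_comp_norm {f : ℝ → ℝ} {f' : ℝ} {x : E} (hx : x ≠ 0) (hf : HasDerivAt f f' ‖x‖) :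
    HasFDerivAt (fun y => f ‖y‖) ((f' / ‖x‖) • innerSL ℝ x) x := by
  have hx' : 0 < ‖x‖ := norm_pos_iff.2 hx
  have h1 : HasFDerivAt (fun y : E => ‖y‖) (‖x‖⁻¹ • innerSL ℝ x) x := by
    have h2 := (hasStrictFDerivAt_norm_sq x).hasFDerivAt.sqrt (pow_ne_zero 2 hx'.ne')
    simp only [Real.sqrt_sq (norm_nonneg _)] at h2
    refine h2.congr_fderiv ?_
    ext v
    simp
    field_simp
  refine (hf.comp_hasFDerivAt x h1).congr_fderiv ?_
  rw [smul_smul, div_eq_mul_inv]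

lemma norm_gradient_comp_norm [CompleteSpace E] {f : ℝ → ℝ} {x : E} (hx : x ≠ 0)
    (hf : DifferentiableAt ℝ f ‖x‖) : ‖gradient (fun y => f ‖y‖) x‖ = |deriv f ‖x‖| := by
  rw [gradient, LinearIsometryEquiv.norm_map, (hasFDerivAt_comp_norm hx hf.hasDerivAt).fderiv,
    norm_smul, innerSL_apply_norm, norm_div, norm_norm, Real.norm_eq_abs,
    div_mul_cancel₀ _ (norm_ne_zero_iff.2 hx)]

/-- With `k = f' / r`, the gradient is `k(|y|) y` and the Hessian at `x` is `k · I + (k' / |x|) x ⊗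
x`; its trace is `N k + |x| k'`, `N` being the dimension. -/
lemma laplacian_comp_norm [FiniteDimensional ℝ E] {a : ℝ} {f : ℝ → ℝ} {g : smoothFun}
    (h : IsLogLift a f g) {x : E} (hx : x ≠ 0) :
    Laplacian.laplacian (fun y : E => f ‖y‖) x =
      radialLaplacian (Module.finrank ℝ E) f ‖x‖ := by
  have hx' : 0 < ‖x‖ := norm_pos_iff.2 hx
  set k : ℝ → ℝ := fun s => deriv f s / s with hk
  have h1 : fderiv ℝ (fun y : E => f ‖y‖) =ᶠ[𝓝 x] fun y => k ‖y‖ • innerSL ℝ y := by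
    filter_upwards [isOpen_ne.mem_nhds hx] with y hy
    exact (hasFDerivAt_comp_norm hy
      (h.differentiableAt (norm_pos_iff.2 hy)).hasDerivAt).fderiv
  have h2 : HasFDerivAt (fun y : E => k ‖y‖) ((deriv k ‖x‖ / ‖x‖) • innerSL ℝ x) x :=
    hasFDerivAt_comp_norm hx (h.lift_deriv.lift_div_id.differentiableAt hx').hasDerivAt
  have h3 : HasFDerivAt (fun y : E => k ‖y‖ • innerSL ℝ y) _ x :=
    h2.smul (innerSL ℝ (E := E)).hasFDerivAt
  have h4 : ∀ v : E, fderiv ℝ (fderiv ℝ fun y : E => f ‖y‖) x v v =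
      k ‖x‖ * ‖v‖ ^ 2 + deriv k ‖x‖ / ‖x‖ * inner ℝ x v ^ 2 := by
    intro v
    rw [h1.fderiv_eq, HasFDerivAt.fderiv h3]
    have h6 : innerSL ℝ v v = ‖v‖ ^ 2 := real_inner_self_eq_norm_sq v
    simp [h6]
    ring
  have h5 : ∑ i, inner ℝ x (stdOrthonormalBasis ℝ E i) ^ 2 = ‖x‖ ^ 2 :=
    (stdOrthonormalBasis ℝ E).sum_sq_inner_left x
  rw [InnerProductSpace.laplacian_eq_iteratedFDeriv_stdOrthonormalBasis]
  simp only [iteratedFDeriv_two_apply, Matrix.cons_val_zero, Matrix.cons_val_one, h4,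
    Finset.sum_add_distrib, ← Finset.mul_sum, h5]
  simp only [radialLaplacian, ← hk, OrthonormalBasis.norm_eq_one, one_pow, Finset.sum_const,
    Finset.card_univ, Fintype.card_fin, nsmul_eq_mul, mul_one]
  rw [← show k ‖x‖ = deriv f ‖x‖ / ‖x‖ from rfl]
  field_simp
  ring

/-- The origin is null, so only the values of `F` off `0` and of `f` on `(0, ∞)` matter; the profile
is arbitrary elsewhere. -/
lemma lintegral_comp_norm [Nontrivial E] [FiniteDimensional ℝ E] [MeasurableSpace E] [BorelSpace E]
    (μ : Measure E) [μ.IsAddHaarMeasure] {f : ℝ → ℝ≥0∞} (hf : Measurable fun r : Ioi (0 : ℝ) => f r)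
    {F : E → ℝ≥0∞} (hF : ∀ x, x ≠ 0 → F x = f ‖x‖) :
    ∫⁻ x, F x ∂μ = μ.toSphere univ *
      ∫⁻ r in Ioi (0 : ℝ), f r * ENNReal.ofReal (r ^ (Module.finrank ℝ E - 1)) :=
  calc
    ∫⁻ x, F x ∂μ = ∫⁻ x : ({(0)}ᶜ : Set E), F x.1 ∂(μ.comap (↑)) := by
      rw [lintegral_subtype_comap (measurableSet_singleton _).compl, restrict_compl_singleton]
    _ = ∫⁻ x : ({(0)}ᶜ : Set E), f ‖x.1‖ ∂(μ.comap (↑)) :=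
      lintegral_congr fun x => hF x.1 x.2
    _ = ∫⁻ x, f x.2 ∂μ.toSphere.prod (.volumeIoiPow (Module.finrank ℝ E - 1)) := by
      simpa using μ.measurePreserving_homeomorphUnitSphereProd.lintegral_comp_emb
        (Homeomorph.measurableEmbedding _) (fun p => f p.2)
    _ = μ.toSphere univ * ∫⁻ r : Ioi (0 : ℝ), f r ∂.volumeIoiPow (Module.finrank ℝ E - 1) := by
      have h : Measurable fun p : Metric.sphere (0 : E) 1 × Ioi (0 : ℝ) => f p.2 :=
        hf.comp measurable_snd
      rw [lintegral_prod _ h.aemeasurable]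
      simp only [lintegral_const, mul_comm]
    _ = _ := by
      rw [Measure.volumeIoiPow, lintegral_withDensity_eq_lintegral_mul _ (by fun_prop) hf,
        ← lintegral_subtype_comap measurableSet_Ioi]
      simp [mul_comm]

end radial

/-! ### The Laplacian and the norms in the logarithmic variable. -/

lemma IsLogLift.lift_radialLaplacian {a : ℝ} {f : ℝ → ℝ} {g : smoothFun} (h : IsLogLift a f g) (N : ℕ) :
    IsLogLift (a + 2) (radialLaplacian N f)
      (smoothFun.diffOp ((Polynomial.X + Polynomial.C (N - 2 - a)) *
        (Polynomial.X + Polynomial.C (-a))) g) := by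
  intro t
  have h1 := h.lift_deriv.lift_div_id
  have h2 := h1 t
  have h3 := h1.lift_deriv t
  set G := smoothFun.diffOp (Polynomial.X + Polynomial.C (-a)) g with hG
  rw [smoothFun.diffOp_mul, ← hG, smoothFun.diffOp_X_add_C]
  rw [smoothFun.diffOp_X_add_C] at h3
  change (smoothFun.D G).1 t + -(a + 1 + 1) * G.1 t = _ at h3
  change (smoothFun.D G).1 t + (N - 2 - a) * G.1 t = _
  have h4 : (smoothFun.D G).1 t + (N - 2 - a) * G.1 t =
    ((smoothFun.D G).1 t + -(a + 1 + 1) * G.1 t) + N * G.1 t := by ring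
  rw [h4, h3, h2, show (a + 1 + 1 + 1) * t = (a + 2) * t + t by ring, Real.exp_add,
    show (a + 1 + 1) * t = (a + 2) * t by ring]
  simp only [radialLaplacian]
  ring

lemma IsLogLift.lift_iterate_radialLaplacian {a : ℝ} {f : ℝ → ℝ} {g : smoothFun} (h : IsLogLift a f g)
    (N m : ℕ) :
    IsLogLift (a + 2 * m) ((radialLaplacian N)^[m] f)
      (smoothFun.diffOp ((∏ l ∈ Finset.range m, (Polynomial.X + Polynomial.C (N - 2 - (a + 2 * l)))) *
        ∏ l ∈ Finset.range m, (Polynomial.X + Polynomial.C (-(a + (2 * l : ℕ))))) g) := by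
  induction m with
  | zero => simpa [smoothFun.diffOp] using h
  | succ m ih =>
    have := ih.lift_radialLaplacian N
    rw [← smoothFun.diffOp_mul] at this
    rw [Function.iterate_succ_apply', Finset.prod_range_succ, Finset.prod_range_succ]
    convert this using 1
    · push_cast
      ring
    · push_cast
      congr 2
      ring

lemma IsLogLift.iterLaplacian_eq {a : ℝ} {f : ℝ → ℝ} {g : smoothFun} (h : IsLogLift a f g)
    (N m : ℕ) {x : EuclideanSpace ℝ (Fin N)} (hx : x ≠ 0) :
    iterLaplacian N m (radialFun N f) x = (radialLaplacian N)^[m] f ‖x‖ := by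
  induction m generalizing x with
  | zero => rfl
  | succ m ih =>
    have h1 : iterLaplacian N m (radialFun N f) =ᶠ[𝓝 x]
        fun y => (radialLaplacian N)^[m] f ‖y‖ := by
      filter_upwards [isOpen_ne.mem_nhds hx] with y hy using ih hy
    have h2 := (InnerProductSpace.laplacian_congr_nhds h1).eq_of_nhds
    rw [laplacian_comp_norm (h.lift_iterate_radialLaplacian N m) hx, finrank_euclideanSpace_fin] at h2
    rw [Function.iterate_succ_apply', ← h2, iterLaplacian, Function.iterate_succ_apply']
    rfl

lemma IsLogLift.norm_gradient_iterLaplacian {a : ℝ} {f : ℝ → ℝ} {g : smoothFun}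
    (h : IsLogLift a f g) (N m : ℕ) {x : EuclideanSpace ℝ (Fin N)} (hx : x ≠ 0) :
    ‖gradient (iterLaplacian N m (radialFun N f)) x‖ =
      |deriv ((radialLaplacian N)^[m] f) ‖x‖| := by
  have h1 : iterLaplacian N m (radialFun N f) =ᶠ[𝓝 x]
      fun y => (radialLaplacian N)^[m] f ‖y‖ := by
    filter_upwards [isOpen_ne.mem_nhds hx] with y hy using h.iterLaplacian_eq N m hy
  rw [← norm_gradient_comp_norm hx
    ((h.lift_iterate_radialLaplacian N m).differentiableAt (norm_pos_iff.2 hx)), gradient, gradient,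
    h1.fderiv_eq]

/-- Here `r^(N-1) dr = exp (N t) dt`, so `N / 2` is the weight that makes the lift an L² isometry.
-/
lemma IsLogLift.lintegral_Ioi {N : ℕ} (hN : 1 ≤ N) {f : ℝ → ℝ} {g : smoothFun}
    (h : IsLogLift (N / 2) f g) :
    ∫⁻ r in Ioi (0 : ℝ), ENNReal.ofReal (|f r| ^ 2 * r ^ (N - 1)) = smoothFun.sqNorm g := by
  have h1 := lintegral_image_eq_lintegral_abs_deriv_mul MeasurableSet.univ
    (fun x _ => (Real.hasDerivAt_exp x).hasDerivWithinAt) Real.exp_injective.injOn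
    (fun r => ENNReal.ofReal (|f r| ^ 2 * r ^ (N - 1)))
  rw [image_univ, Real.range_exp, Measure.restrict_univ] at h1
  rw [h1, smoothFun.sqNorm]
  refine lintegral_congr fun t => ?_
  rw [← ENNReal.ofReal_mul (abs_nonneg _), abs_of_pos (Real.exp_pos t), h t, sq_abs, mul_left_comm,
    ← pow_succ', Nat.sub_add_cancel hN, mul_pow, ← Real.exp_nat_mul, ← Real.exp_nat_mul, mul_comm,
    show ((2 : ℕ) : ℝ) * (N / 2 * t) = N * t by push_cast; ring]

lemma IsLogLift.lintegral_euclideanSpace {N : ℕ} (hN : 1 ≤ N) {f : ℝ → ℝ} {g : smoothFun}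
    (h : IsLogLift (N / 2) f g) {F : EuclideanSpace ℝ (Fin N) → ℝ}
    (hF : ∀ x, x ≠ 0 → F x = |f ‖x‖|) :
    ∫⁻ x, ENNReal.ofReal (F x ^ 2) = sphereArea N * smoothFun.sqNorm g := by
  have : Nonempty (Fin N) := ⟨⟨0, hN⟩⟩
  have hm : Measurable fun r : Ioi (0 : ℝ) => ENNReal.ofReal (|f r| ^ 2) := by
    have : Measurable fun r : Ioi (0 : ℝ) => f r :=
      (continuousOn_iff_continuous_domRestrict.1 h.continuousOn).measurable
    exact ((continuous_abs.measurable.comp this).pow_const 2).ennreal_ofReal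
  rw [lintegral_comp_norm volume (f := fun r => ENNReal.ofReal (|f r| ^ 2)) hm
    fun x hx => by rw [hF x hx], ← h.lintegral_Ioi hN, sphereArea, finrank_euclideanSpace_fin]
  simp only [ENNReal.ofReal_mul (sq_nonneg _)]

/-! ### Matching the factors and conclusion. -/

section

open Polynomial smoothFun

lemma Finset.prod_range_two_mul {M : Type*} [CommMonoid M] (a : ℕ → M) (m : ℕ) :
    ∏ j ∈ Finset.range (2 * m), a j =
      (∏ l ∈ Finset.range m, a (2 * l + 1)) * ∏ l ∈ Finset.range m, a (2 * l) := by
  induction m with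
  | zero => simp
  | succ m ih =>
    rw [Nat.mul_succ, Finset.prod_range_succ, Finset.prod_range_succ, ih, Finset.prod_range_succ,
      Finset.prod_range_succ, mul_mul_mul_comm, mul_assoc, mul_comm (a (2 * m))]

lemma Finset.prod_erase_zero_range_succ {M : Type*} [CommMonoid M] (a : ℕ → M) (m : ℕ) :
    ∏ l ∈ (Finset.range (m + 1)).erase 0, a l = ∏ l ∈ Finset.range m, a (l + 1) := by
  have : (Finset.range (m + 1)).erase 0 = (Finset.range m).image (· + 1) := by
    ext l
    simp only [Finset.mem_erase, Finset.mem_range, Finset.mem_image]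
    constructor
    · rintro ⟨h0, h1⟩
      exact ⟨l - 1, by omega, by omega⟩
    · rintro ⟨k, hk, rfl⟩
      omega
  rw [this, Finset.prod_image fun _ _ _ _ h => Nat.succ_injective h]

/-- The even factors and the factor with index `0` among the factors with indices `0, 2, 3, …`. -/
lemma prod_range_two_mul_add_two {M : Type*} [CommMonoid M] (b : ℕ → M) (n : ℕ) :
    (∏ j ∈ Finset.range (2 * n), b (j + 2)) * b 0 =
      (∏ l ∈ (Finset.range (n + 1)).erase 0, b (2 * l + 1)) *
        ∏ l ∈ Finset.range (n + 1), b (2 * l) := by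
  rw [Finset.prod_range_two_mul, Finset.prod_erase_zero_range_succ, Finset.prod_range_succ',
    mul_assoc]
  rfl

/-- Division by `r` raises the weight without differentiating, so compared with `n + 2` derivatives
exactly the factor of index `1` is missing. -/
lemma IsLogLift.lift_iteratedDeriv_deriv_div {a : ℝ} {f : ℝ → ℝ} {g : smoothFun}
    (h : IsLogLift a f g) (n : ℕ) :
    IsLogLift (a + (n + 2 : ℕ)) (iteratedDeriv n fun s => deriv f s / s)
      (diffOp ((∏ j ∈ Finset.range n, (X + C (-(a + (j + 2 : ℕ))))) *
        (X + C (-(a + (0 : ℕ))))) g) := by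
  have := h.lift_deriv.lift_div_id.lift_iteratedDeriv n
  rw [← diffOp_mul] at this
  have h1 : a + (n + 2 : ℕ) = a + 1 + 1 + n := by
    push_cast
    ring
  have h2 : ∀ j : ℕ, a + (j + 2 : ℕ) = a + 1 + 1 + j := fun j => by
    push_cast
    ring
  simpa only [h1, h2, Nat.cast_zero, add_zero] using this

lemma IsLogLift.tendsto_of_decayProfile {N k : ℕ} {U : ℝ → ℝ} {w : smoothFun}
    (hw : IsLogLift (N / 2) (iteratedDeriv k fun s => deriv U s / s) w)
    (h : Tendsto (decayProfile N k U) (𝓝[>] 0) (𝓝 0)) : Tendsto w.1 atBot (𝓝 0) := by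
  refine (h.comp Real.tendsto_exp_atBot_nhdsGT).congr fun t => ?_
  rw [hw t, Function.comp, decayProfile, ← Real.exp_mul, mul_comm t, mul_comm]

/-- The comparison underlying both parts of the theorem: here `K - 2 m` is `0` or `1`, `y` is
the profile in the logarithmic variable with weight `a = N / 2 - K`, and `R` collects the remaining
factors. -/
lemma sqNorm_le_of_decay {N K m : ℕ} (hN : 1 ≤ N) (hK : 2 * m ≤ K) (hNK : K ≤ N + 1) {a : ℝ}
    (ha : a = N / 2 - K) (R : ℝ[X]) {y : smoothFun}
    (hw : 1 ≤ m → Tendsto (diffOp ((∏ l ∈ (Finset.range m).erase 0,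
      (X + C (-(a + (2 * l + 1 : ℕ))))) * R) y).1 atBot (𝓝 0)) :
    sqNorm (diffOp ((∏ l ∈ Finset.range m, (X + C (-(a + (2 * l + 1 : ℕ))))) * R) y) ≤
      sqNorm (diffOp ((∏ l ∈ Finset.range m, (X + C (N - 2 - (a + 2 * l)))) * R) y) := by
  rcases Nat.eq_zero_or_pos m with rfl | hm
  · simp
  have hN' : (1 : ℝ) ≤ N := by exact_mod_cast hN
  have hl : ∀ l ∈ Finset.range m, (2 * l + 2 : ℝ) ≤ K := fun l hl => by
    have := Finset.mem_range.1 hl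
    exact_mod_cast (show 2 * l + 2 ≤ K by omega)
  simp only [diffOp_mul _ R]
  refine sqNorm_diffOp_prod_le_of_tendsto (a := 0) (fun l hl' => ?_) (fun l hl' => ?_)
    (fun l _ i _ h => ?_) (Finset.mem_range.2 hm) (fun l hl' i hi h => ?_) ?_
  -- Here `β_l = N/2 + K - 2 - 2l` and `α_l = K - N/2 - 2l - 1`: `α_l ≤ β_l` amounts to `N ≥ 1`, and
  -- `-α_l ≤ β_l` to `4l + 3 ≤ 2K`.
  · have := hl l hl'
    rw [abs_le, ha]
    push_cast
    constructor <;> linarith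
  · have := hl l hl'
    rw [ha]
    linarith
  · have h' : (l : ℝ) = i := by linarith
    exact_mod_cast h'
  -- A coincidence `α_l = β_i` means `N + 2l = 2i + 1`, impossible since `l ≥ 1` and `2i + 1 ≤ 2m -
  -- 1 ≤ N`. For `l = 0` it does occur when `N = 2m - 1`.
  · rw [Finset.mem_erase, Finset.mem_range] at hl'
    rw [Finset.mem_range] at hi
    rw [ha] at h
    have h1 : (N : ℝ) + 2 * l = 2 * i + 1 := by
      push_cast at h
      linarith
    have h2 : N + 2 * l = 2 * i + 1 := by exact_mod_cast h1
    omega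
  · rw [← diffOp_mul]
    exact hw hm

variable {N m : ℕ} {U : ℝ → ℝ}

lemma lintegral_iteratedDeriv_even_le (hN : 1 ≤ N) (hU : ContDiffOn ℝ ∞ U (Ioi 0)) (hm : 1 ≤ m)
    (hmN : 2 * m - 1 ≤ N) (h0 : Tendsto (decayProfile N (2 * m - 2) U) (𝓝[>] 0) (𝓝 0)) :
    sphereArea N * ∫⁻ r in Ioi (0 : ℝ),
        ENNReal.ofReal (|iteratedDeriv (2 * m) U r| ^ 2 * r ^ (N - 1)) ≤
      ∫⁻ x : EuclideanSpace ℝ (Fin N),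
        ENNReal.ofReal (|iterLaplacian N m (radialFun N U) x| ^ 2) := by
  -- This weight rises to `N / 2` after `2m` derivatives; the common factors `R` are those of even
  -- index.
  obtain ⟨a, ha⟩ : ∃ a : ℝ, a = N / 2 - (2 * m : ℕ) := ⟨_, rfl⟩
  have ha' : a + (2 * m : ℕ) = N / 2 := by rw [ha]; ring
  obtain ⟨y, hy⟩ := IsLogLift.exists_of_contDiffOn hU a
  have hder := hy.lift_iteratedDeriv (2 * m)
  have hlap := hy.lift_iterate_radialLaplacian N m
  rw [ha', Finset.prod_range_two_mul] at hder
  rw [show a + 2 * m = N / 2 by rw [← ha']; push_cast; ring] at hlap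
  rw [hder.lintegral_Ioi hN, hlap.lintegral_euclideanSpace hN fun x hx => by
    rw [hy.iterLaplacian_eq N m hx]]
  refine mul_le_mul_right (sqNorm_le_of_decay hN le_rfl (by omega) ha _ fun _ => ?_) _
  obtain ⟨n, rfl⟩ := Nat.exists_eq_add_of_le' hm
  have hw := hy.lift_iteratedDeriv_deriv_div (2 * n)
  rw [show a + (2 * n + 2 : ℕ) = N / 2 from ha',
    prod_range_two_mul_add_two fun j => X + C (-(a + (j : ℕ)))] at hw
  exact hw.tendsto_of_decayProfile h0

lemma lintegral_iteratedDeriv_odd_le (hN : 1 ≤ N) (hU : ContDiffOn ℝ ∞ U (Ioi 0))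
    (hmN : 2 * m ≤ N) (h0 : 1 ≤ m → Tendsto (decayProfile N (2 * m - 1) U) (𝓝[>] 0) (𝓝 0)) :
    sphereArea N * ∫⁻ r in Ioi (0 : ℝ),
        ENNReal.ofReal (|iteratedDeriv (2 * m + 1) U r| ^ 2 * r ^ (N - 1)) ≤
      ∫⁻ x : EuclideanSpace ℝ (Fin N),
        ENNReal.ofReal (‖gradient (iterLaplacian N m (radialFun N U)) x‖ ^ 2) := by
  -- Now `K = 2m + 1`; the last derivative, radial or from the gradient, contributes the same factor
  -- of index `2m` on both sides, which joins `R`.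
  obtain ⟨a, ha⟩ : ∃ a : ℝ, a = N / 2 - (2 * m + 1 : ℕ) := ⟨_, rfl⟩
  have ha' : a + (2 * m + 1 : ℕ) = N / 2 := by rw [ha]; ring
  obtain ⟨y, hy⟩ := IsLogLift.exists_of_contDiffOn hU a
  have hder := hy.lift_iteratedDeriv (2 * m + 1)
  have hlap := (hy.lift_iterate_radialLaplacian N m).lift_deriv
  rw [ha', Finset.prod_range_succ, Finset.prod_range_two_mul, mul_assoc] at hder
  rw [show a + 2 * m + 1 = N / 2 by rw [← ha']; push_cast; ring, ← diffOp_mul, mul_comm, mul_assoc,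
    show a + 2 * m = a + (2 * m : ℕ) by push_cast; ring] at hlap
  rw [hder.lintegral_Ioi hN, hlap.lintegral_euclideanSpace hN fun x hx =>
    hy.norm_gradient_iterLaplacian N m hx]
  refine mul_le_mul_right (sqNorm_le_of_decay hN (by omega) (by omega) ha _ fun hm => ?_) _
  obtain ⟨n, rfl⟩ := Nat.exists_eq_add_of_le' hm
  have hw := hy.lift_iteratedDeriv_deriv_div (2 * n + 1)
  rw [show a + (2 * n + 1 + 2 : ℕ) = N / 2 from ha', Finset.prod_range_succ, mul_right_comm,
    prod_range_two_mul_add_two fun j => X + C (-(a + (j : ℕ))), mul_assoc] at hw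
  exact hw.tendsto_of_decayProfile (h0 hm)

end

theorem mainTheorem4 (N : ℕ) (hN : 1 ≤ N) (U : ℝ → ℝ) (hU : ContDiffOn ℝ ∞ U (Set.Ioi 0)) :
    (∀ m : ℕ, 1 ≤ m → 2 * m - 1 ≤ N →
      Tendsto (decayProfile N (2 * m - 2) U) (𝓝[>] 0) (𝓝 0) →
      Tendsto (decayProfile N (2 * m - 2) U) atTop (𝓝 0) →
      sphereArea N *
          ∫⁻ r in Set.Ioi (0 : ℝ),
            ENNReal.ofReal (|iteratedDeriv (2 * m) U r| ^ 2 * r ^ (N - 1)) ≤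
        ∫⁻ x : EuclideanSpace ℝ (Fin N),
          ENNReal.ofReal (|iterLaplacian N m (radialFun N U) x| ^ 2)) ∧
    (∀ m : ℕ, 2 * m ≤ N →
      (1 ≤ m → Tendsto (decayProfile N (2 * m - 1) U) (𝓝[>] 0) (𝓝 0)) →
      (1 ≤ m → Tendsto (decayProfile N (2 * m - 1) U) atTop (𝓝 0)) →
      sphereArea N *
          ∫⁻ r in Set.Ioi (0 : ℝ),
            ENNReal.ofReal (|iteratedDeriv (2 * m + 1) U r| ^ 2 * r ^ (N - 1)) ≤
        ∫⁻ x : EuclideanSpace ℝ (Fin N),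
          ENNReal.ofReal (‖gradient (iterLaplacian N m (radialFun N U)) x‖ ^ 2)) :=
  ⟨fun _ hm hmN h0 _ => lintegral_iteratedDeriv_even_le hN hU hm hmN h0,
    fun _ hmN h0 _ => lintegral_iteratedDeriv_odd_le hN hU hmN h0⟩
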